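/- Let $\alpha,\beta$ be non-zero complex numbers with $m\alpha+n\beta=0$ for relatively prime positive integers $m,n$. Consider the equation $$p(u)q(u)=p(u+\beta)\,q(u+\alpha),\qquad (*)$$ for $p,q\in\mathbb{C}[u]$; products of pairs are taken componentwise. A solution $(p,q)\neq(1,1)$ of $(*)$ with $p,q$ monic is called irreducible if, whenever $(p,q)=(p_1,q_1)(p_2,q_2)$ with both $(p_i,q_i)$ solutions of $(*)$, either $p_1,q_1$ are both constant or $p_2,q_2$ are both constant. For a coset $c\in\mathbb{C}/(\mathbb{Z}\alpha+\mathbb{Z}\beta)$, a solution with $p,q$ monic is called $c$-integral if every zero of $p(u)q(u)$ lies in $c$. Let $\mathscr{D}(m,n)$ be the set of generalized Dyck paths $\pi=((x_0,y_0),\dots,(x_{m+n},y_{m+n}))$, that is, sequences of points of $\mathbb{Z}_{\ge0}^2$ from $(0,0)$ to $(m,n)$ in which each step is $(1,0)$ or $(0,1)$ and $m y_i\ge n x_i$ for all $i$. For $\pi\in\mathscr{D}(m,n)$ and $\lambda\in\mathbb{C}$ put $$P_1^{\pi,\lambda}(u)=\prod_{\substack{1\le i\le m+n\\ x_i=x_{i-1}}}\bigl(u-(\lambda+x_i\alpha+y_i\beta)\bigr),\qquad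 P_2^{\pi,\lambda}(u)=\prod_{\substack{1\le i\le m+n\\ y_i=y_{i-1}}}\bigl(u-(\lambda+x_i\alpha+y_i\beta)\bigr).$$ Fix a coset $c$ and an origin $z_0\in c$. Every $\lambda\in c$ is uniquely $\lambda=z_0+k\alpha+l\beta$ with $0\le k\le m-1$, $l\in\mathbb{Z}$; to $(\pi,\lambda)\in\mathscr{D}(m,n)\times c$ one associates the cylindrical Dyck path $\overline{\pi}_{kl}$, the sequence of the classes of $(x_i+k,y_i+l)$, $0\le i\le m+n$, in the cylinder $\mathbb{Z}^2/\mathbb{Z}(m,n)$. Write $(\pi,\lambda)\preceq(\tau,\mu)$ if the cylindrical path of $(\pi,\lambda)$ lies to the south-east of that of $(\tau,\mu)$: whenever the classes of $(x,y)\in\mathbb{Z}^2$ and $(x',y')\in\mathbb{Z}^2$ are points of the first and of the second path respectively, and $x+y=x'+y'$, then $y-x\le y'-x'$. Then, for every choice of $z_0\in c$ and every $c$-integral solution $(p,q)$, there exist a unique integer $k\ge0$ and a unique sequence $\bigl((\pi_1,\lambda_1),\dots,(\pi_k,\lambda_k)\bigr)$ of elements of $\mathscr{D}(m,n)\times c$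 such that $$(\pi_1,\lambda_1)\preceq(\pi_2,\lambda_2)\preceq\cdots\preceq(\pi_k,\lambda_k)\qquad\text{and}\qquad (p,q)=\prod_{i=1}^{k}\bigl(P_1^{\pi_i,\lambda_i},P_2^{\pi_i,\lambda_i}\bigr).$$ Moreover, every pair $(P_1^{\pi,\lambda},P_2^{\pi,\lambda})$ with $(\pi,\lambda)\in\mathscr{D}(m,n)\times c$ is an irreducible solution of $(*)$. -/

import Mathlib

open Polynomial

namespace ShiftEq

/-- `(p, q)` solves `p(u) q(u) = p(u + β) q(u + α)`. -/
def IsSolution (α β : ℂ) (P : ℂ[X] × ℂ[X]) : Prop :=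
  P.1 * P.2 = P.1.comp (X + C β) * P.2.comp (X + C α)

/-- A solution in which both polynomials are monic (hence non-zero). -/
def IsMonicSolution (α β : ℂ) (P : ℂ[X] × ℂ[X]) : Prop :=
  P.1.Monic ∧ P.2.Monic ∧ IsSolution α β P

/-- Irreducible solutions: non-trivial monic solutions such that, in every factorization into two
(not necessarily monic) solutions, one of the two factors consists of constants. -/
def IsIrreducibleSolution (α β : ℂ) (P : ℂ[X] × ℂ[X]) : Prop :=
  IsMonicSolution α β P ∧ P ≠ 1 ∧
    ∀ A B : ℂ[X] × ℂ[X], IsSolution α β A → IsSolution α β B → P = A * B →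
      (A.1.natDegree = 0 ∧ A.2.natDegree = 0) ∨ (B.1.natDegree = 0 ∧ B.2.natDegree = 0)

/-- The subgroup `ℤα + ℤβ` of `ℂ`. -/
def latticeGroup (α β : ℂ) : AddSubgroup ℂ :=
  AddSubgroup.zmultiples α ⊔ AddSubgroup.zmultiples β

/-- `c`-integral solutions: monic solutions such that all zeros of `p q` lie in the coset `c`. -/
def IsIntegralSolution (α β : ℂ) (c : ℂ ⧸ latticeGroup α β) (P : ℂ[X] × ℂ[X]) : Prop :=
  IsMonicSolution α β P ∧
    ∀ z : ℂ, (P.1 * P.2).IsRoot z → (z : ℂ ⧸ latticeGroup α β) = c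

/-- Generalized Dyck paths from `(0,0)` to `(m,n)`: the points `(x_0,y_0), …, (x_{m+n},y_{m+n})` of
a lattice path with unit steps to the right and up, with `m y_i ≥ n x_i` for all `i`. (A lattice
path with these end points necessarily has `m + n` steps.) -/
@[ext] structure DyckPath (m n : ℕ) where
  pt : Fin (m + n + 1) → ℕ × ℕ
  start : pt 0 = (0, 0)
  finish : pt (Fin.last (m + n)) = (m, n)
  step : ∀ i : Fin (m + n),
    pt i.succ = ((pt i.castSucc).1 + 1, (pt i.castSucc).2) ∨
      pt i.succ = ((pt i.castSucc).1, (pt i.castSucc).2 + 1)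
  above : ∀ i : Fin (m + n + 1), n * (pt i).1 ≤ m * (pt i).2

/-- The pair `(P₁^{π,z}, P₂^{π,z})`: the first (second) polynomial has the factor
`u - (z + x_i α + y_i β)` for each `i = 1, …, m + n` with `x_i = x_{i-1}` (`y_i = y_{i-1}`). -/
noncomputable def pathSolution (α β : ℂ) {m n : ℕ} (π : DyckPath m n) (z : ℂ) : ℂ[X] × ℂ[X] :=
  (∏ i : Fin (m + n),
      (X - C (z + ((π.pt i.succ).1 : ℂ) * α + ((π.pt i.succ).2 : ℂ) * β)) ^
        (if (π.pt i.succ).1 = (π.pt i.castSucc).1 then 1 else 0),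
   ∏ i : Fin (m + n),
      (X - C (z + ((π.pt i.succ).1 : ℂ) * α + ((π.pt i.succ).2 : ℂ) * β)) ^
        (if (π.pt i.succ).2 = (π.pt i.castSucc).2 then 1 else 0))

/-- The discrete cylinder `ℤ² / ℤ(m,n)`. -/
abbrev Cylinder (m n : ℕ) : Type :=
  (ℤ × ℤ) ⧸ AddSubgroup.zmultiples ((m : ℤ), (n : ℤ))

/-- The sequence on the cylinder obtained by translating `π` by `(k,l)` and projecting. -/
def cylSeq {m n : ℕ} (π : DyckPath m n) (k l : ℤ) : Fin (m + n + 1) → Cylinder m n :=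
  fun i => QuotientAddGroup.mk (((π.pt i).1 : ℤ) + k, ((π.pt i).2 : ℤ) + l)

/-- Cylindrical Dyck paths: the sequences `cylSeq π k l` with `0 ≤ k ≤ m - 1` and `l ∈ ℤ`. -/
def CylDyckPath (m n : ℕ) : Type :=
  {γ : Fin (m + n + 1) → Cylinder m n //
    ∃ (π : DyckPath m n) (k l : ℤ), 0 ≤ k ∧ k < (m : ℤ) ∧ γ = cylSeq π k l}

/-- `γ` lies completely to the south-east of `δ`. -/
def CylDyckPath.SouthEast {m n : ℕ} (γ δ : CylDyckPath m n) : Prop :=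
  ∀ x y x' y' : ℤ,
    (QuotientAddGroup.mk (x, y) : Cylinder m n) ∈ Set.range γ.1 →
    (QuotientAddGroup.mk (x', y') : Cylinder m n) ∈ Set.range δ.1 →
    x + y = x' + y' → y - x ≤ y' - x'

/-- The set `𝒟(m,n) × c`. -/
abbrev PathIn (m n : ℕ) {α β : ℂ} (c : ℂ ⧸ latticeGroup α β) : Type :=
  DyckPath m n × {z : ℂ // (z : ℂ ⧸ latticeGroup α β) = c}

/-- With origin `z₀`, the pair `(π, z₀ + k α + l β)` with `0 ≤ k ≤ m - 1` corresponds to the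
cylindrical Dyck path `cylSeq π k l`. -/
def CorrespondsTo {m n : ℕ} {α β : ℂ} {c : ℂ ⧸ latticeGroup α β} (z₀ : ℂ)
    (a : PathIn m n c) (γ : CylDyckPath m n) : Prop :=
  ∃ k l : ℤ, 0 ≤ k ∧ k < (m : ℤ) ∧ (a.2 : ℂ) = z₀ + (k : ℂ) * α + (l : ℂ) * β ∧
    γ.1 = cylSeq a.1 k l

/-- The correspondence is a well-defined map `𝒟(m,n) × c → 𝒟^cyl(m,n)` for every origin in `c`. -/
theorem existsUnique_correspondsTo {m n : ℕ} {α β : ℂ} (hβ : β ≠ 0)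
    (hm : 0 < m) (hmn : Nat.Coprime m n) (h : (m : ℂ) * α + (n : ℂ) * β = 0)
    {c : ℂ ⧸ latticeGroup α β} (z₀ : ℂ) (hz₀ : (z₀ : ℂ ⧸ latticeGroup α β) = c)
    (a : PathIn m n c) : ∃! γ : CylDyckPath m n, CorrespondsTo z₀ a γ := by
  obtain ⟨π, z, hz⟩ := a
  have hmem : -z₀ + z ∈ latticeGroup α β := QuotientAddGroup.eq.1 (hz₀.trans hz.symm)
  obtain ⟨_, ⟨k, rfl⟩, _, ⟨l, rfl⟩, hkl⟩ := AddSubgroup.mem_sup.1 hmem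
  simp only [zsmul_eq_mul] at hkl
  have hm' : (m : ℤ) ≠ 0 := by exact_mod_cast hm.ne'
  have hk : (k : ℂ) = (m : ℂ) * ((k / m : ℤ) : ℂ) + ((k % m : ℤ) : ℂ) := by
    exact_mod_cast (Int.mul_ediv_add_emod k m).symm
  refine ⟨⟨cylSeq π (k % m) (l - n * (k / m)), π, _, _, Int.emod_nonneg _ hm',
    Int.emod_lt_of_pos _ (by omega), rfl⟩, ⟨k % m, l - n * (k / m), Int.emod_nonneg _ hm',
    Int.emod_lt_of_pos _ (by omega), ?_, rfl⟩, ?_⟩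
  · push_cast
    linear_combination (-1 : ℂ) * hkl + α * hk + ((k / m : ℤ) : ℂ) * h
  · rintro ⟨γ, hγ⟩ ⟨k', l', h0, h1, h2, h3⟩
    apply Subtype.ext
    change z = _ at h2
    have e : (k' - k) * (n : ℤ) = (l' - l) * m := by
      have : ((k' - k) * (n : ℂ) - (l' - l) * m) * β = 0 := by
        linear_combination (k' - k : ℂ) * h + (m : ℂ) * h2 + (m : ℂ) * hkl
      have := (mul_eq_zero.1 this).resolve_right hβ
      exact_mod_cast sub_eq_zero.1 this
    have hd : (m : ℤ) ∣ k' - k :=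
      IsCoprime.dvd_of_dvd_mul_right (Nat.isCoprime_iff_coprime.2 hmn) (e ▸ dvd_mul_left _ _)
    have hk' : k % m = k' := by
      have e2 : k % m = k' % m := Int.modEq_iff_dvd.2 hd
      rw [e2, Int.emod_eq_of_lt h0 h1]
    have hl' : l - n * (k / m) = l' := by
      have := Int.mul_ediv_add_emod k m
      apply mul_right_cancel₀ hm'
      rw [hk'] at this
      linear_combination e - (n : ℤ) * this
    change γ = cylSeq π k' l' at h3
    change γ = cylSeq π (k % m) (l - n * (k / m))
    rw [h3, hk', hl']

/-- The order on `𝒟(m,n) × c` transferred from cylindrical Dyck paths by means of the origin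
`z₀`. -/
def SouthEast {m n : ℕ} {α β : ℂ} {c : ℂ ⧸ latticeGroup α β} (z₀ : ℂ)
    (a b : PathIn m n c) : Prop :=
  ∃ γ δ : CylDyckPath m n, CorrespondsTo z₀ a γ ∧ CorrespondsTo z₀ b δ ∧ γ.SouthEast δ

end ShiftEq

open ShiftEq

/-! Since `m α + n β = 0` with `m`, `n` coprime, `(x, y) ↦ m y - n x` identifies the cylinder
`ℤ² / ℤ(m, n)`, and with it the coset of `z₀`, with `ℤ`. Regard every zero of `p` at the integer `e`
as an edge `e - m ⟶ e` and every zero of `q` as an edge `e + n ⟶ e`. Equation `(*)` then says that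
at each integer as many edges end as start. The numbers `C e` of edges that end in
`e, e - (m + n), e - 2 (m + n), …` determine the zeros, and conservation of the flow makes `C`
monotone under translation by `m` and by `n`.

The levels of a Dyck path form a closed walk along such edges, whose `C` is the indicator of a set
bounded below and stable under `+ m` and `+ n`. Conversely, the least elements of such a set in the
residue classes modulo `m + n` trace out exactly one path. The south-east order becomes reverse
inclusion, so the factorizations of a solution into a chain of paths are the decompositions of `C`
into a decreasing sequence of indicators, of which there is only one: the sets `{e | i < C e}`. Two
stable sets always meet, so an indicator is not the sum of two non-zero profiles; hence the
solutions of paths are irreducible. -/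

namespace ShiftEq

open Filter

section Layers

variable {ι X : Type*} {f : ι → Set X}

lemma lt_sum_indicator_iff {L : List ι} (hL : L.Pairwise fun a b => f b ⊆ f a) (x : X) (i : ℕ) :
    i < (L.map fun a => (f a).indicator (1 : X → ℕ) x).sum ↔ ∃ hi : i < L.length, x ∈ f L[i] := by
  induction L generalizing i with
  | nil => simp
  | cons a L ih =>
    rw [List.pairwise_cons] at hL
    rw [List.map_cons, List.sum_cons]
    by_cases hx : x ∈ f a
    · rw [Set.indicator_of_mem hx, Pi.one_apply]
      cases i with
      | zero => simp [hx]
      | succ i =>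
        rw [add_comm 1, Nat.add_lt_add_iff_right]
        simpa using ih hL.2 i
    · have not_mem : ∀ b ∈ L, x ∉ f b := fun b hb hxb => hx (hL.1 b hb hxb)
      rw [Set.indicator_of_notMem hx, zero_add, ih hL.2]
      cases i with
      | zero => simp +contextual [hx, not_mem]
      | succ i => simp +contextual [not_mem]

lemma list_eq_of_sum_indicator_eq (hinj : Function.Injective f) (hne : ∀ a, (f a).Nonempty)
    {L L' : List ι} (hL : L.Pairwise fun a b => f b ⊆ f a)
    (hL' : L'.Pairwise fun a b => f b ⊆ f a)
    (h : ∀ x, (L.map fun a => (f a).indicator (1 : X → ℕ) x).sum =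
      (L'.map fun a => (f a).indicator (1 : X → ℕ) x).sum) : L = L' := by
  have layer : ∀ i x, (∃ hi : i < L.length, x ∈ f L[i]) ↔ ∃ hi : i < L'.length, x ∈ f L'[i] :=
    fun i x => by rw [← lt_sum_indicator_iff hL, h, lt_sum_indicator_iff hL']
  have length_iff : ∀ i, i < L.length ↔ i < L'.length := fun i =>
    ⟨fun hi => let ⟨x, hx⟩ := hne L[i]; ((layer i x).1 ⟨hi, hx⟩).1,
      fun hi => let ⟨x, hx⟩ := hne L'[i]; ((layer i x).2 ⟨hi, hx⟩).1⟩
  refine List.ext_getElem (eq_of_forall_lt_iff length_iff) fun i hi hi' => hinj ?_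
  ext x
  simpa [hi, hi'] using layer i x

theorem existsUnique_list_sum_indicator_eq (hinj : Function.Injective f)
    (hne : ∀ a, (f a).Nonempty) {C : X → ℕ} (hC : BddAbove (Set.range C))
    (hlayer : ∀ i, {x | i < C x}.Nonempty → {x | i < C x} ∈ Set.range f) :
    ∃! L : List ι, L.Pairwise (fun a b => f b ⊆ f a) ∧
      ∀ x, (L.map fun a => (f a).indicator (1 : X → ℕ) x).sum = C x := by
  obtain ⟨N, hN, hlt⟩ : ∃ N, (∀ x, C x ≤ N) ∧ ∀ i < N, {x | i < C x}.Nonempty := by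
    rcases isEmpty_or_nonempty X with _ | _
    · exact ⟨0, isEmptyElim, by simp⟩
    · obtain ⟨x, hx⟩ := Nat.sSup_mem (Set.range_nonempty C) hC
      exact ⟨C x, fun y => hx ▸ le_csSup hC ⟨y, rfl⟩, fun i hi => ⟨x, hi⟩⟩
  choose g hg using fun i : Fin N => hlayer i (hlt i i.2)
  have anti : (List.ofFn g).Pairwise fun a b => f b ⊆ f a := by
    refine List.pairwise_ofFn.2 fun i j hij x hx => ?_
    rw [hg] at hx ⊢
    exact (Fin.lt_def.1 hij).trans hx
  have sum_eq : ∀ x, ((List.ofFn g).map fun a => (f a).indicator (1 : X → ℕ) x).sum = C x := by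
    refine fun x => eq_of_forall_lt_iff fun i => ?_
    rw [lt_sum_indicator_iff anti]
    simp only [List.length_ofFn, List.getElem_ofFn, hg, Set.mem_ofPred_eq, exists_prop,
      and_iff_right_iff_imp]
    exact fun hi => hi.trans_le (hN x)
  exact ⟨_, ⟨anti, sum_eq⟩, fun L hL =>
    list_eq_of_sum_indicator_eq hinj hne hL.1 anti fun x => by rw [hL.2, sum_eq]⟩

end Layers

lemma eq_of_periodic_of_eventually_atBot {β : Type*} {f : ℤ → β} {M : ℤ} (hM : 0 < M)
    (hf : Function.Periodic f M) {b : β} (hb : ∀ᶠ e in atBot, f e = b) (e : ℤ) : f e = b := by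
  obtain ⟨B, hB⟩ := eventually_atBot.1 hb
  have below : e - (e - B).toNat * M ≤ B := by
    nlinarith [Int.self_le_toNat (e - B), Int.natCast_nonneg (e - B).toNat]
  rw [← hf.sub_nat_mul_eq (e - B).toNat, hB _ below]

/-- A non-empty set of integers which is bounded below and closed under translation by `m` and
`n`: a semimodule over the numerical semigroup generated by `m` and `n`. -/
structure IsSemimodule (m n : ℕ) (U : Set ℤ) : Prop where
  nonempty : U.Nonempty
  bddBelow : BddBelow U
  add_left_mem : ∀ e ∈ U, e + m ∈ U
  add_right_mem : ∀ e ∈ U, e + n ∈ U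

lemma exists_modEq_add_mul {m n : ℕ} (hm : 0 < m) (hmn : m.Coprime n) (t e : ℤ) :
    ∃ i < m + n, t + m * (i : ℕ) ≡ e [ZMOD m + n] := by
  obtain ⟨u, hu⟩ := Int.mod_coprime (Nat.coprime_self_add_right.2 hmn)
  obtain ⟨i, hi, hiu⟩ := Int.existsUnique_equiv_nat (u * (e - t)) (b := m + n) (by omega)
  push_cast at hu
  refine ⟨i, by omega, ?_⟩
  calc t + m * (i : ℤ) ≡ t + m * (u * (e - t)) [ZMOD m + n] := (hiu.mul_left _).add_left _
    _ = t + m * u * (e - t) := by ring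
    _ ≡ t + 1 * (e - t) [ZMOD m + n] := (hu.mul_right _).add_left _
    _ = e := by ring

lemma modEq_cancel_left {m n : ℕ} (hmn : m.Coprime n) {i j : ℤ}
    (h : m * i ≡ m * j [ZMOD m + n]) : i ≡ j [ZMOD m + n] := by
  obtain ⟨u, hu⟩ := Int.mod_coprime (Nat.coprime_self_add_right.2 hmn)
  push_cast at hu
  calc i = 1 * i := by ring
    _ ≡ m * u * i [ZMOD m + n] := hu.symm.mul_right _
    _ = u * (m * i) := by ring
    _ ≡ u * (m * j) [ZMOD m + n] := h.mul_left _
    _ = m * u * j := by ring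
    _ ≡ 1 * j [ZMOD m + n] := hu.mul_right _
    _ = j := by ring

namespace IsSemimodule

variable {m n : ℕ} {U V : Set ℤ}

lemma add_mul_mem (hU : IsSemimodule m n U) {e : ℤ} (he : e ∈ U) (x y : ℕ) :
    e + m * x + n * y ∈ U := by
  have left : e + m * x ∈ U := by
    induction x with
    | zero => simpa using he
    | succ x ih => simpa [mul_add, add_assoc] using hU.add_left_mem _ ih
  induction y with
  | zero => simpa using left
  | succ y ih => simpa [mul_add, add_assoc] using hU.add_right_mem _ ih

lemma mem_of_le_of_modEq (hU : IsSemimodule m n U) {e e' : ℤ} (he : e ∈ U) (hle : e ≤ e')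
    (hmod : e ≡ e' [ZMOD m + n]) : e' ∈ U := by
  obtain ⟨k, rfl⟩ := Int.modEq_iff_add_fac.1 hmod
  rcases le_or_gt 0 k with hk | hk
  · lift k to ℕ using hk
    convert hU.add_mul_mem he k k using 1
    ring
  · convert he
    nlinarith

lemma inter_nonempty (hmn : m.Coprime n) (hU : IsSemimodule m n U) (hV : IsSemimodule m n V) :
    (U ∩ V).Nonempty := by
  obtain ⟨e, he⟩ := hU.nonempty
  obtain ⟨e', he'⟩ := hV.nonempty
  obtain ⟨u, v, huv⟩ := Nat.isCoprime_iff_coprime.2 hmn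
  set x := u * (e' - e)
  set y := v * (e' - e)
  refine ⟨e + m * x.toNat + n * y.toNat, hU.add_mul_mem he _ _, ?_⟩
  convert hV.add_mul_mem he' (-x).toNat (-y).toNat using 1
  linear_combination (m : ℤ) * Int.toNat_sub_toNat_neg x + n * Int.toNat_sub_toNat_neg y +
    (e' - e) * huv

lemma exists_isLeast_modEq (hm : 0 < m) (hmn : m.Coprime n) (hU : IsSemimodule m n U) (r : ℤ) :
    ∃ v, IsLeast {e ∈ U | e ≡ r [ZMOD m + n]} v := by
  obtain ⟨e, he⟩ := hU.nonempty
  obtain ⟨i, -, hi⟩ := exists_modEq_add_mul hm hmn e r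
  obtain ⟨B, hB⟩ := hU.bddBelow
  obtain ⟨v, hv, hmin⟩ := Int.exists_least_of_bdd (P := fun e => e ∈ U ∧ e ≡ r [ZMOD m + n])
    ⟨B, fun z hz => hB hz.1⟩ ⟨_, by simpa using hU.add_mul_mem he i 0, hi⟩
  exact ⟨v, hv, hmin⟩

end IsSemimodule

/-- The arithmetic progression `v, v + M, v + 2M, …`. -/
def ray (M v : ℤ) : Set ℤ :=
  {e | v ≤ e ∧ v ≡ e [ZMOD M]}

section Ray

variable {M : ℤ}

lemma add_mem_ray_add_iff {v e : ℤ} (d : ℤ) : e + d ∈ ray M (v + d) ↔ e ∈ ray M v :=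
  and_congr (add_le_add_iff_right d) ⟨Int.ModEq.add_right_cancel' d, Int.ModEq.add_right d⟩

lemma indicator_ray_add (v e d : ℤ) :
    (ray M (v + d)).indicator (1 : ℤ → ℕ) (e + d) = (ray M v).indicator 1 e := by
  classical
  simp only [Set.indicator_apply, add_mem_ray_add_iff, Pi.one_apply]

lemma mem_ray_iff_eq_or_sub_mem (hM : 0 < M) {v e : ℤ} :
    e ∈ ray M v ↔ v = e ∨ e - M ∈ ray M v := by
  have modEq_iff : v ≡ e - M [ZMOD M] ↔ v ≡ e [ZMOD M] := by simp
  refine ⟨fun ⟨hle, hmod⟩ => hle.eq_or_lt.imp_right fun hlt => ⟨?_, modEq_iff.2 hmod⟩, ?_⟩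
  · linarith [Int.le_of_dvd (sub_pos.2 hlt) hmod.dvd]
  · rintro (rfl | ⟨hle, hmod⟩)
    · exact ⟨le_rfl, rfl⟩
    · exact ⟨by linarith, modEq_iff.1 hmod⟩

lemma ite_add_indicator_ray_sub (hM : 0 < M) (v e : ℤ) :
    (if v = e then 1 else 0) + (ray M v).indicator (1 : ℤ → ℕ) (e - M) =
      (ray M v).indicator 1 e := by
  classical
  rcases eq_or_ne v e with rfl | hne
  · have not_mem : v - M ∉ ray M v := fun hv => by linarith [hv.1]
    simp [not_mem, mem_ray_iff_eq_or_sub_mem hM (v := v) (e := v)]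
  · simp [hne, Set.indicator_apply, mem_ray_iff_eq_or_sub_mem hM (v := v) (e := e)]

end Ray

/-- The profile of the flow on `ℤ` which has `a e` edges `e - m ⟶ e` and `b e` edges
`e + n ⟶ e`: `C e` is the number of edges ending in `e`, `e - (m + n)`, `e - 2 (m + n)`, …. It
is encoded by recursions in terms of `C e` and `C (e - m)`, which determine `a` and `b`. -/
structure IsProfile (m n : ℕ) (a b C : ℤ → ℕ) : Prop where
  eventually_eq_zero : ∀ᶠ e in atBot, C e = 0
  up : ∀ e, a e + C (e - (m + n)) = C (e - m)
  right : ∀ e, b e + C (e - m) = C e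

namespace IsProfile

variable {m n : ℕ} {a b C a' b' C' : ℤ → ℕ}

lemma total (h : IsProfile m n a b C) (e : ℤ) : a e + b e + C (e - (m + n)) = C e := by
  rw [← h.right e, ← h.up e]
  ring

lemma unique (hm : 0 < m) (h : IsProfile m n a b C) (h' : IsProfile m n a b C') : C = C' := by
  have periodic : Function.Periodic (fun e => (C e : ℤ) - C' e) (m + n) := fun e => by
    have total := h.total (e + (m + n))
    have total' := h'.total (e + (m + n))
    rw [add_sub_cancel_right] at total total'
    dsimp only
    lia
  have eventually : ∀ᶠ e in atBot, (C e : ℤ) - C' e = 0 := by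
    filter_upwards [h.eventually_eq_zero, h'.eventually_eq_zero] with e he he'
    simp [he, he']
  funext e
  have := eq_of_periodic_of_eventually_atBot (by lia) periodic eventually e
  lia

lemma left_unique (h : IsProfile m n a b C) (h' : IsProfile m n a' b' C) : a = a' ∧ b = b' :=
  ⟨funext fun e => Nat.add_right_cancel ((h.up e).trans (h'.up e).symm),
    funext fun e => Nat.add_right_cancel ((h.right e).trans (h'.right e).symm)⟩

lemma add (h : IsProfile m n a b C) (h' : IsProfile m n a' b' C') :
    IsProfile m n (a + a') (b + b') (C + C') where
  eventually_eq_zero := by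
    filter_upwards [h.eventually_eq_zero, h'.eventually_eq_zero] with e he he'
    simp [he, he']
  up e := by
    simp only [Pi.add_apply, ← h.up e, ← h'.up e]
    ring
  right e := by
    simp only [Pi.add_apply, ← h.right e, ← h'.right e]
    ring

protected lemma zero : IsProfile m n 0 0 0 :=
  ⟨by simp, fun _ => rfl, fun _ => rfl⟩

lemma le_add_left (h : IsProfile m n a b C) (e : ℤ) : C e ≤ C (e + m) := by
  have := h.right (e + m)
  rw [add_sub_cancel_right] at this
  lia

lemma le_add_right (h : IsProfile m n a b C) (e : ℤ) : C e ≤ C (e + n) := by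
  have := h.up (e + (m + n))
  rw [add_sub_cancel_right, show e + (m + n : ℤ) - m = e + n by ring] at this
  lia

lemma isSemimodule_setOf_lt (h : IsProfile m n a b C) {i : ℕ} (hi : {e | i < C e}.Nonempty) :
    IsSemimodule m n {e | i < C e} where
  nonempty := hi
  bddBelow := by
    obtain ⟨B, hB⟩ := eventually_atBot.1 h.eventually_eq_zero
    refine ⟨B, fun e (he : i < C e) => ?_⟩
    by_contra! hlt
    simp [hB e hlt.le] at he
  add_left_mem _ he := lt_of_lt_of_le he (h.le_add_left _)
  add_right_mem _ he := lt_of_lt_of_le he (h.le_add_right _)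

lemma eq_zero_or_eq_zero_of_add_le_one (hmn : m.Coprime n) (h : IsProfile m n a b C)
    (h' : IsProfile m n a' b' C') (hle : ∀ e, (C + C') e ≤ 1) : C = 0 ∨ C' = 0 := by
  by_contra! hne
  obtain ⟨e, he⟩ := Function.ne_iff.1 hne.1
  obtain ⟨e', he'⟩ := Function.ne_iff.1 hne.2
  have hU := h.isSemimodule_setOf_lt (i := 0) ⟨e, Nat.pos_of_ne_zero he⟩
  have hU' := h'.isSemimodule_setOf_lt (i := 0) ⟨e', Nat.pos_of_ne_zero he'⟩
  obtain ⟨d, hd, hd'⟩ := hU.inter_nonempty hmn hU'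
  rw [Set.mem_ofPred_eq] at hd hd'
  have := hle d
  rw [Pi.add_apply] at this
  lia

lemma of_total (hm : 0 < m) (hC : ∀ᶠ e in atBot, C e = 0)
    (htotal : ∀ e, a e + b e + C (e - (m + n)) = C e)
    (hflow : ∀ e, a e + b e = a (e + m) + b (e - n)) : IsProfile m n a b C := by
  have periodic : Function.Periodic (fun e => (C e : ℤ) - C (e - m) - b e) (m + n) := fun e => by
    have total := htotal (e + (m + n))
    have total' := htotal (e + n)
    have flow := hflow (e + n)
    rw [add_sub_cancel_right] at total flow
    rw [show e + n - (m + n : ℤ) = e - m by ring] at total'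
    rw [show e + n + (m : ℤ) = e + (m + n) by ring] at flow
    dsimp only
    rw [show e + (m + n) - (m : ℤ) = e + n by ring]
    lia
  have eventually : ∀ᶠ e in atBot, (C e : ℤ) - C (e - m) - b e = 0 := by
    filter_upwards [hC, (tendsto_atBot_add_const_right _ (-m : ℤ) tendsto_id).eventually hC]
      with e he he'
    have total := htotal e
    rw [id, ← sub_eq_add_neg] at he'
    lia
  have right : ∀ e, b e + C (e - m) = C e := fun e => by
    have := eq_of_periodic_of_eventually_atBot (by lia) periodic eventually e
    lia
  refine ⟨hC, fun e => ?_, right⟩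
  have := htotal e
  have := right e
  lia

end IsProfile

lemma exists_isProfile {m n : ℕ} (hm : 0 < m) {a b : ℤ → ℕ} (hfin : (a + b).support.Finite)
    (hflow : ∀ e, a e + b e = a (e + m) + b (e - n)) :
    ∃ C, IsProfile m n a b C ∧ BddAbove (Set.range C) := by
  set S := hfin.toFinset
  set C : ℤ → ℕ := fun e => ∑ v ∈ S, (a + b) v * (ray (m + n) v).indicator 1 e with hC
  have total : ∀ e, a e + b e + C (e - (m + n)) = C e := fun e => by
    have sum_single : ∑ v ∈ S, (a + b) v * (if v = e then 1 else 0) = a e + b e := by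
      simp only [mul_boole, Finset.sum_ite_eq']
      refine ite_eq_left_iff.2 fun he => ?_
      exact (Function.notMem_support.1 fun hmem => he (hfin.mem_toFinset.2 hmem)).symm
    rw [← sum_single, hC, ← Finset.sum_add_distrib]
    refine Finset.sum_congr rfl fun v _ => ?_
    rw [← mul_add, ite_add_indicator_ray_sub (by lia)]
  have eventually : ∀ᶠ e in atBot, C e = 0 := by
    obtain ⟨B, hB⟩ := S.bddBelow
    filter_upwards [eventually_lt_atBot B] with e he
    refine Finset.sum_eq_zero fun v hv => ?_
    rw [Set.indicator_of_notMem fun hmem => (he.trans_le (hB hv)).not_ge hmem.1, mul_zero]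
  refine ⟨C, .of_total hm eventually total hflow, ∑ v ∈ S, (a + b) v, ?_⟩
  rintro _ ⟨e, rfl⟩
  exact Finset.sum_le_sum fun v _ =>
    mul_le_of_le_one_right' (Set.indicator_le_self' (by simp) e)

lemma IsSemimodule.isLeast_modEq_step {m n : ℕ} {U : Set ℤ} (hm : 0 < m) (hU : IsSemimodule m n U)
    {r a b : ℤ} (ha : IsLeast {e ∈ U | e ≡ r [ZMOD m + n]} a)
    (hb : IsLeast {e ∈ U | e ≡ r + m [ZMOD m + n]} b) : b = a + m ∨ b = a - n := by
  have le_up : b ≤ a + m := hb.2 ⟨hU.add_left_mem _ ha.1.1, ha.1.2.add_right _⟩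
  have le_right : a ≤ b + n := ha.2 ⟨hU.add_right_mem _ hb.1.1, calc
    b + n ≡ r + m + n [ZMOD m + n] := hb.1.2.add_right _
    _ = r + (m + n) := by ring
    _ ≡ r [ZMOD m + n] := by simp⟩
  obtain ⟨k, hk⟩ := (hb.1.2.trans (ha.1.2.add_right _).symm).dvd
  have k_lower : 0 ≤ k := by
    by_contra! hlt
    nlinarith
  have k_upper : k ≤ 1 := by
    by_contra! hlt
    nlinarith
  obtain rfl | rfl : k = 0 ∨ k = 1 := by lia
  · left; linarith
  · right; linarith

namespace DyckPath

variable {m n : ℕ} (π τ : DyckPath m n) (t r : ℤ)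

/-- The level `m y - n x` of the `i`-th point `(x, y)` of the path, normalized to start at `t`.
Up-steps add `m` to it, steps to the right subtract `n`. -/
def level (i : Fin (m + n + 1)) : ℤ :=
  t + m * (π.pt i).2 - n * (π.pt i).1

lemma pt_fst_add_snd (i : Fin (m + n + 1)) : (π.pt i).1 + (π.pt i).2 = i := by
  induction i using Fin.induction with
  | zero => simp [π.start]
  | succ i ih =>
    rw [Fin.val_castSucc] at ih
    rw [Fin.val_succ, ← ih]
    rcases π.step i with h | h <;> rw [h] <;> dsimp only <;> ring

lemma level_zero : π.level t 0 = t := by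
  simp [level, π.start]

lemma level_last : π.level t (Fin.last _) = t := by
  simp only [level, π.finish]
  ring

lemma le_level (i : Fin (m + n + 1)) : t ≤ π.level t i := by
  have : (n * (π.pt i).1 : ℤ) ≤ m * (π.pt i).2 := mod_cast π.above i
  unfold level
  lia

lemma level_step (i : Fin (m + n)) :
    ((π.pt i.succ).1 = (π.pt i.castSucc).1 ∧ (π.pt i.succ).2 ≠ (π.pt i.castSucc).2 ∧
      π.level t i.succ = π.level t i.castSucc + m) ∨
    ((π.pt i.succ).1 ≠ (π.pt i.castSucc).1 ∧ (π.pt i.succ).2 = (π.pt i.castSucc).2 ∧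
      π.level t i.succ = π.level t i.castSucc - n) := by
  unfold level
  rcases π.step i with h | h <;> rw [h]
  · refine .inr ⟨by simp, rfl, ?_⟩
    push_cast
    ring
  · refine .inl ⟨rfl, by simp, ?_⟩
    push_cast
    ring

lemma level_modEq (i : Fin (m + n + 1)) : π.level t i ≡ t + m * (i : ℕ) [ZMOD m + n] := by
  refine Int.modEq_iff_add_fac.2 ⟨(π.pt i).1, ?_⟩
  rw [level, ← π.pt_fst_add_snd i]
  push_cast
  ring

lemma castSucc_eq_of_level_modEq (hmn : m.Coprime n) {i j : Fin (m + n)}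
    (h : π.level t i.castSucc ≡ π.level t j.castSucc [ZMOD m + n]) : i = j := by
  have times : t + m * (i : ℕ) ≡ t + m * (j : ℕ) [ZMOD m + n] :=
    (π.level_modEq t i.castSucc).symm.trans (h.trans (π.level_modEq t j.castSucc))
  have := modEq_cancel_left hmn (times.add_left_cancel' t)
  exact Fin.ext (Nat.ModEq.eq_of_lt_of_lt (Int.natCast_modEq_iff.1 (by exact_mod_cast this))
    i.2 j.2)

lemma exists_level_castSucc_eq (hm : 0 < m) (i : Fin (m + n + 1)) :
    ∃ j : Fin (m + n), π.level t j.castSucc = π.level t i := by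
  induction i using Fin.lastCases with
  | last => exact ⟨⟨0, by lia⟩, (π.level_zero t).trans (π.level_last t).symm⟩
  | cast j => exact ⟨j, rfl⟩

lemma exists_level_modEq (hm : 0 < m) (hmn : m.Coprime n) (e : ℤ) :
    ∃ i, π.level t i ≡ e [ZMOD m + n] := by
  obtain ⟨i, hi, h⟩ := exists_modEq_add_mul hm hmn t e
  exact ⟨⟨i, by lia⟩, (π.level_modEq t _).trans h⟩

/-- The integers that lie above a level of the path (normalized to start at `t`) in the residue
class of that level modulo `m + n`. -/
def semimodule : Set ℤ :=
  ⋃ i : Fin (m + n), ray (m + n) (π.level t i.castSucc)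

/-- The number of up-steps that end in level `e`. -/
def upCount (e : ℤ) : ℕ :=
  ∑ i : Fin (m + n), (if (π.pt i.succ).1 = (π.pt i.castSucc).1 then 1 else 0) *
    (if π.level t i.succ = e then 1 else 0)

/-- The number of steps to the right that end in level `e`. -/
def rightCount (e : ℤ) : ℕ :=
  ∑ i : Fin (m + n), (if (π.pt i.succ).2 = (π.pt i.castSucc).2 then 1 else 0) *
    (if π.level t i.succ = e then 1 else 0)

section Profile

variable {π t}

lemma indicator_semimodule (hmn : m.Coprime n) (e : ℤ) :
    (π.semimodule t).indicator (1 : ℤ → ℕ) e =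
      ∑ i : Fin (m + n), (ray (m + n) (π.level t i.castSucc)).indicator 1 e := by
  have := Finset.indicator_biUnion Finset.univ
    (fun i : Fin (m + n) => ray (m + n) (π.level t i.castSucc)) (f := (1 : ℤ → ℕ))
    fun i _ j _ hij => Set.disjoint_left.2 fun e hi hj =>
      hij (π.castSucc_eq_of_level_modEq t hmn (hi.2.trans hj.2.symm))
  simpa [semimodule] using congrFun this e

lemma indicator_semimodule_eq_sum_succ (hmn : m.Coprime n) (e : ℤ) :
    (π.semimodule t).indicator (1 : ℤ → ℕ) e =
      ∑ i : Fin (m + n), (ray (m + n) (π.level t i.succ)).indicator 1 e := by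
  have sum_succ := Fin.sum_univ_succ fun i =>
    (ray (m + n) (π.level t i)).indicator (1 : ℤ → ℕ) e
  have sum_castSucc := Fin.sum_univ_castSucc fun i =>
    (ray (m + n) (π.level t i)).indicator (1 : ℤ → ℕ) e
  rw [level_zero] at sum_succ
  rw [level_last] at sum_castSucc
  rw [indicator_semimodule hmn]
  lia

lemma isProfile (hm : 0 < m) (hmn : m.Coprime n) :
    IsProfile m n (π.upCount t) (π.rightCount t) ((π.semimodule t).indicator 1) where
  eventually_eq_zero := by
    filter_upwards [eventually_lt_atBot t] with e he
    refine Set.indicator_of_notMem (fun hmem => ?_) _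
    obtain ⟨i, hi⟩ := Set.mem_iUnion.1 hmem
    exact (he.trans_le (π.le_level t _)).not_ge hi.1
  up e := by
    rw [indicator_semimodule_eq_sum_succ hmn, indicator_semimodule hmn, upCount,
      ← Finset.sum_add_distrib]
    refine Finset.sum_congr rfl fun i _ => ?_
    rcases π.level_step t i with ⟨h, -, hl⟩ | ⟨h, -, hl⟩
    · rw [if_pos h, one_mul, ite_add_indicator_ray_sub (by lia), hl,
        ← indicator_ray_add _ (e - m) m, sub_add_cancel]
    · rw [if_neg h, hl, zero_mul, zero_add, ← indicator_ray_add _ _ (n : ℤ), sub_add_cancel,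
        sub_add_eq_sub_sub, sub_add_cancel]
  right e := by
    rw [indicator_semimodule_eq_sum_succ hmn e, indicator_semimodule hmn, rightCount,
      ← Finset.sum_add_distrib]
    refine Finset.sum_congr rfl fun i _ => ?_
    rcases π.level_step t i with ⟨-, h, hl⟩ | ⟨-, h, hl⟩
    · rw [if_neg h, hl, zero_mul, zero_add, ← indicator_ray_add _ _ (m : ℤ), sub_add_cancel]
    · rw [if_pos h, one_mul, ← ite_add_indicator_ray_sub (by lia) (π.level t i.succ) e, hl,
        ← indicator_ray_add _ (e - (m + n)) n, sub_add_cancel, sub_add_eq_sub_sub, sub_add_cancel]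

end Profile

section Order

variable {π τ t r}

lemma mem_semimodule_iff (hm : 0 < m) {e : ℤ} :
    e ∈ π.semimodule t ↔ ∃ i, e ∈ ray (m + n) (π.level t i) := by
  refine Set.mem_iUnion.trans ⟨fun ⟨i, hi⟩ => ⟨_, hi⟩, fun ⟨i, hi⟩ => ?_⟩
  obtain ⟨j, hj⟩ := π.exists_level_castSucc_eq t hm i
  exact ⟨j, hj ▸ hi⟩

lemma mem_semimodule_iff_of_modEq (hm : 0 < m) (hmn : m.Coprime n) {i : Fin (m + n + 1)} {e : ℤ}
    (h : π.level t i ≡ e [ZMOD m + n]) : e ∈ π.semimodule t ↔ π.level t i ≤ e := by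
  refine ⟨fun he => ?_, fun hle => (mem_semimodule_iff hm).2 ⟨i, hle, h⟩⟩
  obtain ⟨j, hle, hj⟩ := Set.mem_iUnion.1 he
  obtain ⟨k, hk⟩ := π.exists_level_castSucc_eq t hm i
  obtain rfl := π.castSucc_eq_of_level_modEq t hmn (hj.trans (hk ▸ h).symm)
  exact hk ▸ hle

lemma semimodule_subset_iff (hm : 0 < m) (hmn : m.Coprime n) :
    τ.semimodule r ⊆ π.semimodule t ↔
      ∀ i j, π.level t i ≡ τ.level r j [ZMOD m + n] → π.level t i ≤ τ.level r j := by
  refine ⟨fun h i j hij => (mem_semimodule_iff_of_modEq hm hmn hij).1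
    (h ((mem_semimodule_iff hm).2 ⟨j, le_rfl, rfl⟩)), fun h e he => ?_⟩
  obtain ⟨j, hle, hj⟩ := (mem_semimodule_iff hm).1 he
  obtain ⟨i, hi⟩ := π.exists_level_modEq t hm hmn e
  exact (mem_semimodule_iff_of_modEq hm hmn hi).2 ((h i j (hi.trans hj.symm)).trans hle)

lemma isLeast_semimodule (hm : 0 < m) : IsLeast (π.semimodule t) t := by
  refine ⟨(mem_semimodule_iff hm).2 ⟨0, ?_⟩, fun e he => ?_⟩
  · rw [level_zero]
    exact ⟨le_rfl, rfl⟩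
  · obtain ⟨i, hi⟩ := Set.mem_iUnion.1 he
    exact (π.le_level t _).trans hi.1

lemma eq_and_eq_of_semimodule_eq (hm : 0 < m) (hmn : m.Coprime n)
    (h : π.semimodule t = τ.semimodule r) : π = τ ∧ t = r := by
  obtain rfl : t = r := by
    refine (isLeast_semimodule (π := π) hm).unique ?_
    rw [h]
    exact isLeast_semimodule hm
  refine ⟨DyckPath.ext (funext fun i => ?_), rfl⟩
  have modEq := (π.level_modEq t i).trans (τ.level_modEq t i).symm
  have level_eq : π.level t i = τ.level t i :=
    le_antisymm ((semimodule_subset_iff hm hmn).1 h.ge i i modEq)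
      ((semimodule_subset_iff hm hmn).1 h.le i i modEq.symm)
  have sum_eq := (π.pt_fst_add_snd i).trans (τ.pt_fst_add_snd i).symm
  unfold level at level_eq
  have snd_eq : (π.pt i).2 = (τ.pt i).2 := by
    zify at sum_eq ⊢
    apply mul_left_cancel₀ (show (m + n : ℤ) ≠ 0 by lia)
    linear_combination level_eq + n * sum_eq
  exact Prod.ext (by lia) snd_eq

end Order

lemma exists_latticePath {m n : ℕ} {v : ℕ → ℤ}
    (hstep : ∀ i, v (i + 1) = v i + m ∨ v (i + 1) = v i - n) :
    ∃ p : ℕ → ℕ × ℕ, p 0 = (0, 0) ∧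
      (∀ i, p (i + 1) = ((p i).1 + 1, (p i).2) ∨ p (i + 1) = ((p i).1, (p i).2 + 1)) ∧
      ∀ i, v 0 + m * (p i).2 - n * (p i).1 = v i := by
  set p : ℕ → ℕ × ℕ := fun i => i.rec (0, 0) fun i q =>
    if v (i + 1) = v i + m then (q.1, q.2 + 1) else (q.1 + 1, q.2)
  have p_succ : ∀ i, p (i + 1) =
      if v (i + 1) = v i + m then ((p i).1, (p i).2 + 1) else ((p i).1 + 1, (p i).2) :=
    fun i => rfl
  refine ⟨p, rfl, fun i => ?_, fun i => ?_⟩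
  · rw [p_succ]
    split_ifs <;> simp
  · induction i with
    | zero => simp [p]
    | succ i ih =>
      rw [p_succ]
      split_ifs with hup
      · rw [hup, ← ih]
        push_cast
        ring
      · rw [(hstep i).resolve_left hup, ← ih]
        push_cast
        ring

lemma exists_level_eq {m n : ℕ} (hm : 0 < m) {v : ℕ → ℤ}
    (hstep : ∀ i, v (i + 1) = v i + m ∨ v (i + 1) = v i - n) (hle : ∀ i, v 0 ≤ v i)
    (hlast : v (m + n) = v 0) : ∃ π : DyckPath m n, ∀ i, π.level (v 0) i = v i := by
  obtain ⟨p, p_zero, p_succ, level_eq⟩ := exists_latticePath hstep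
  have sum_eq : ∀ i, (p i).1 + (p i).2 = i := fun i => by
    induction i with
    | zero => simp [p_zero]
    | succ i ih => rcases p_succ i with h | h <;> rw [h] <;> dsimp only <;> lia
  have snd_last : (p (m + n)).2 = n := by
    have sum_last := sum_eq (m + n)
    zify at sum_last ⊢
    apply mul_left_cancel₀ (show (m + n : ℤ) ≠ 0 by lia)
    linear_combination hlast + level_eq (m + n) + (n : ℤ) * sum_last
  have fst_last : (p (m + n)).1 = m := by
    have := sum_eq (m + n)
    lia
  refine ⟨⟨fun i => p i, p_zero, Prod.ext fst_last snd_last, fun i => p_succ i, fun i => ?_⟩,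
    fun i => level_eq i⟩
  have := hle i
  have := level_eq i
  zify
  lia

end DyckPath

lemma IsSemimodule.exists_semimodule_eq {m n : ℕ} {U : Set ℤ} (hm : 0 < m) (hmn : m.Coprime n)
    (hU : IsSemimodule m n U) : ∃ (π : DyckPath m n) (t : ℤ), π.semimodule t = U := by
  choose least hleast using hU.exists_isLeast_modEq hm hmn
  obtain ⟨t, ht⟩ : ∃ t, IsLeast U t := by
    obtain ⟨B, hB⟩ := hU.bddBelow
    exact Int.exists_least_of_bdd ⟨B, fun z hz => hB hz⟩ hU.nonempty
  have least_congr : ∀ {r r' : ℤ}, r ≡ r' [ZMOD m + n] → least r = least r' := fun {r r'} h =>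
    (hleast r).unique <| by
      have : {e ∈ U | e ≡ r [ZMOD m + n]} = {e ∈ U | e ≡ r' [ZMOD m + n]} :=
        Set.ext fun _ => and_congr_right fun _ => ⟨fun h' => h'.trans h, fun h' => h'.trans h.symm⟩
      exact this ▸ hleast r'
  set v : ℕ → ℤ := fun i => least (t + m * i)
  have v_zero : v 0 = t := le_antisymm ((hleast _).2 ⟨ht.1, by simp⟩) (ht.2 (hleast _).1.1)
  have v_last : v (m + n) = v 0 := least_congr <| by
    rw [Nat.cast_add, Nat.cast_zero, mul_zero]
    exact (Int.ModEq.refl t).add (by simp [Int.modEq_zero_iff_dvd])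
  obtain ⟨π, hπ⟩ := DyckPath.exists_level_eq hm (v := v) (fun i => hU.isLeast_modEq_step hm
    (hleast _) (by convert hleast (t + m * (i + 1 : ℕ)) using 4; push_cast; ring_nf))
    (fun i => v_zero ▸ ht.2 (hleast _).1.1) v_last
  refine ⟨π, v 0, Set.ext fun e => ?_⟩
  obtain ⟨i, hi⟩ := π.exists_level_modEq (v 0) hm hmn e
  rw [DyckPath.mem_semimodule_iff_of_modEq hm hmn hi]
  rw [hπ] at hi ⊢
  exact ⟨fun hle => hU.mem_of_le_of_modEq (hleast _).1.1 hle hi,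
    fun he => (hleast _).2 ⟨he, hi.symm.trans (hleast _).1.2⟩⟩

section Cylinder

variable {m n : ℕ}

lemma cylinder_mk_eq_iff (hm : 0 < m) (hmn : m.Coprime n) {x y x' y' : ℤ} :
    (QuotientAddGroup.mk (x, y) : Cylinder m n) = QuotientAddGroup.mk (x', y') ↔
      (m : ℤ) * y - n * x = m * y' - n * x' := by
  rw [QuotientAddGroup.eq, AddSubgroup.mem_zmultiples_iff]
  simp only [Prod.smul_mk, smul_eq_mul, Prod.neg_mk, Prod.mk_add_mk, Prod.mk.injEq]
  refine ⟨fun ⟨j, hx, hy⟩ => by linear_combination (m : ℤ) * hy - n * hx, fun h => ?_⟩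
  obtain ⟨j, hj⟩ : (m : ℤ) ∣ -x + x' :=
    (Nat.isCoprime_iff_coprime.2 hmn).dvd_of_dvd_mul_left ⟨-y + y', by linear_combination h⟩
  refine ⟨j, by rw [hj, mul_comm], mul_left_cancel₀ (show (m : ℤ) ≠ 0 by lia) ?_⟩
  linear_combination h - (n : ℤ) * hj

lemma mk_mem_range_cylSeq_iff (hm : 0 < m) (hmn : m.Coprime n) {π : DyckPath m n}
    {k l x y : ℤ} : (QuotientAddGroup.mk (x, y) : Cylinder m n) ∈ Set.range (cylSeq π k l) ↔
      ∃ i, π.level (m * l - n * k) i = m * y - n * x := by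
  simp only [Set.mem_range, cylSeq, cylinder_mk_eq_iff hm hmn, DyckPath.level]
  refine exists_congr fun i => ?_
  constructor <;> intro h <;> linear_combination h

lemma CylDyckPath.southEast_iff (hm : 0 < m) (hmn : m.Coprime n) {γ δ : CylDyckPath m n}
    {π τ : DyckPath m n} {k l k' l' : ℤ} (hγ : γ.1 = cylSeq π k l) (hδ : δ.1 = cylSeq τ k' l') :
    γ.SouthEast δ ↔ τ.semimodule (m * l' - n * k') ⊆ π.semimodule (m * l - n * k) := by
  rw [DyckPath.semimodule_subset_iff hm hmn, CylDyckPath.SouthEast, hγ, hδ]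
  simp only [mk_mem_range_cylSeq_iff hm hmn]
  constructor
  · intro h i j hij
    obtain ⟨d, hd⟩ := Int.modEq_iff_add_fac.1 hij
    set x := (π.pt i).1 + k with hx
    set y := (π.pt i).2 + l with hy
    have hi : π.level (m * l - n * k) i = m * y - n * x := by
      rw [DyckPath.level, hx, hy]
      ring
    have := h x y (x - d) (y + d) ⟨i, hi⟩ ⟨j, by linear_combination hd + hi⟩ (by ring)
    nlinarith
  · rintro h x y x' y' ⟨i, hi⟩ ⟨j, hj⟩ hsum
    have level_sub : (m * y' - n * x' : ℤ) = m * y - n * x + (m + n) * (y' - y) := by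
      linear_combination (n : ℤ) * hsum
    have level_le := h i j (by rw [hi, hj, level_sub]; simp)
    rw [hi, hj, level_sub] at level_le
    have : 0 ≤ y' - y := nonneg_of_mul_nonneg_right (by linarith) (show (0 : ℤ) < m + n by lia)
    linarith

end Cylinder

/-- The point of the coset `z₀ + ℤα + ℤβ` in which the integer `e` is placed: for
`m α + n β = 0`, the point `z₀ + x α + y β` is the node `m y - n x`. -/
noncomputable def node (α : ℂ) (n : ℕ) (z₀ : ℂ) (e : ℤ) : ℂ :=
  z₀ - e * (α / n)

section Node

variable {α β : ℂ} {m n : ℕ} {z₀ : ℂ}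

lemma node_zero : node α n z₀ 0 = z₀ := by
  simp [node]

lemma node_injective (hα : α ≠ 0) (hn : 0 < n) : Function.Injective (node α n z₀) := by
  have unit_ne_zero : α / n ≠ 0 := div_ne_zero hα (mod_cast hn.ne')
  intro e e' h
  exact_mod_cast mul_right_cancel₀ unit_ne_zero (sub_right_injective h)

lemma node_add (hn : 0 < n) (h : (m : ℂ) * α + (n : ℂ) * β = 0) (e x y : ℤ) :
    node α n z₀ e + x * α + y * β = node α n z₀ (e + m * y - n * x) := by
  have hn' : (n : ℂ) ≠ 0 := mod_cast hn.ne'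
  unfold node
  field_simp
  push_cast
  linear_combination (y : ℂ) * h

lemma mk_eq_mk_iff {z : ℂ} : (z : ℂ ⧸ latticeGroup α β) = z₀ ↔
    ∃ k l : ℤ, z = z₀ + k * α + l * β := by
  rw [eq_comm, QuotientAddGroup.eq, latticeGroup, AddSubgroup.mem_sup]
  simp only [AddSubgroup.mem_zmultiples_iff, zsmul_eq_mul, exists_exists_eq_and]
  refine exists_congr fun k => exists_congr fun l => ?_
  constructor <;> intro h <;> linear_combination -h

lemma mk_eq_mk_iff_exists_node (hn : 0 < n) (hmn : m.Coprime n)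
    (h : (m : ℂ) * α + (n : ℂ) * β = 0) {z : ℂ} :
    (z : ℂ ⧸ latticeGroup α β) = z₀ ↔ ∃ e, node α n z₀ e = z := by
  rw [mk_eq_mk_iff]
  constructor
  · rintro ⟨k, l, rfl⟩
    exact ⟨0 + m * l - n * k, by rw [← node_add hn h, node_zero]⟩
  · rintro ⟨e, rfl⟩
    obtain ⟨u, v, huv⟩ := Nat.isCoprime_iff_coprime.2 hmn
    refine ⟨-(e * v), e * u, ?_⟩
    conv_rhs => rw [← node_zero (α := α) (n := n) (z₀ := z₀), node_add hn h]
    congr 1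
    linear_combination -e * huv

end Node

/-- The semimodule of a path, placed in the coset of `z₀` so that its least element is the node of
the base point. -/
def pathSemimodule {m n : ℕ} {α β : ℂ} {c : ℂ ⧸ latticeGroup α β} (z₀ : ℂ) (a : PathIn m n c) :
    Set ℤ :=
  {e | ∃ t, node α n z₀ t = a.2 ∧ e ∈ a.1.semimodule t}

section PathSemimodule

variable {α β : ℂ} {m n : ℕ} {z₀ : ℂ} {a b : PathIn m n (z₀ : ℂ ⧸ latticeGroup α β)}

lemma pathSemimodule_eq (hα : α ≠ 0) (hn : 0 < n) {t : ℤ} (ht : node α n z₀ t = a.2) :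
    pathSemimodule z₀ a = a.1.semimodule t := by
  refine Set.ext fun e => ⟨?_, fun he => ⟨t, ht, he⟩⟩
  rintro ⟨t', ht', he⟩
  rwa [node_injective hα hn (ht.trans ht'.symm)]

lemma exists_node_eq (hn : 0 < n) (hmn : m.Coprime n) (h : (m : ℂ) * α + (n : ℂ) * β = 0)
    (a : PathIn m n (z₀ : ℂ ⧸ latticeGroup α β)) : ∃ t, node α n z₀ t = a.2 :=
  (mk_eq_mk_iff_exists_node hn hmn h).1 a.2.2

lemma pathSemimodule_nonempty (hm : 0 < m) (hn : 0 < n) (hmn : m.Coprime n)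
    (h : (m : ℂ) * α + (n : ℂ) * β = 0) (a : PathIn m n (z₀ : ℂ ⧸ latticeGroup α β)) :
    (pathSemimodule z₀ a).Nonempty := by
  obtain ⟨t, ht⟩ := exists_node_eq hn hmn h a
  exact ⟨t, t, ht, (DyckPath.isLeast_semimodule hm).1⟩

lemma pathSemimodule_injective (hα : α ≠ 0) (hm : 0 < m) (hn : 0 < n) (hmn : m.Coprime n)
    (h : (m : ℂ) * α + (n : ℂ) * β = 0) : Function.Injective
      (pathSemimodule z₀ : PathIn m n (z₀ : ℂ ⧸ latticeGroup α β) → Set ℤ) := by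
  intro a b hab
  obtain ⟨t, ht⟩ := exists_node_eq hn hmn h a
  obtain ⟨r, hr⟩ := exists_node_eq hn hmn h b
  rw [pathSemimodule_eq hα hn ht, pathSemimodule_eq hα hn hr] at hab
  obtain ⟨path_eq, rfl⟩ := DyckPath.eq_and_eq_of_semimodule_eq hm hmn hab
  exact Prod.ext path_eq (Subtype.ext (ht.symm.trans hr))

lemma IsSemimodule.mem_range_pathSemimodule (hα : α ≠ 0) (hm : 0 < m) (hn : 0 < n)
    (hmn : m.Coprime n) (h : (m : ℂ) * α + (n : ℂ) * β = 0) {U : Set ℤ} (hU : IsSemimodule m n U) :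
    U ∈ Set.range
      (pathSemimodule z₀ : PathIn m n (z₀ : ℂ ⧸ latticeGroup α β) → Set ℤ) := by
  obtain ⟨π, t, rfl⟩ := hU.exists_semimodule_eq hm hmn
  exact ⟨(π, ⟨node α n z₀ t, (mk_eq_mk_iff_exists_node hn hmn h).2 ⟨t, rfl⟩⟩),
    pathSemimodule_eq hα hn rfl⟩

lemma CorrespondsTo.exists_pathSemimodule_eq (hα : α ≠ 0) (hn : 0 < n)
    (h : (m : ℂ) * α + (n : ℂ) * β = 0) {γ : CylDyckPath m n} (hγ : CorrespondsTo z₀ a γ) :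
    ∃ k l : ℤ, γ.1 = cylSeq a.1 k l ∧ pathSemimodule z₀ a = a.1.semimodule (m * l - n * k) := by
  obtain ⟨k, l, -, -, hz, hγ⟩ := hγ
  refine ⟨k, l, hγ, pathSemimodule_eq hα hn ?_⟩
  rw [hz, ← zero_add ((m : ℤ) * l), ← node_add hn h, node_zero]

lemma southEast_iff (hα : α ≠ 0) (hβ : β ≠ 0) (hm : 0 < m) (hn : 0 < n) (hmn : m.Coprime n)
    (h : (m : ℂ) * α + (n : ℂ) * β = 0) :
    SouthEast z₀ a b ↔ pathSemimodule z₀ b ⊆ pathSemimodule z₀ a := by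
  have key {γ δ : CylDyckPath m n} (hγ : CorrespondsTo z₀ a γ) (hδ : CorrespondsTo z₀ b δ) :
      γ.SouthEast δ ↔ pathSemimodule z₀ b ⊆ pathSemimodule z₀ a := by
    obtain ⟨k, l, hγ, ha⟩ := hγ.exists_pathSemimodule_eq hα hn h
    obtain ⟨k', l', hδ, hb⟩ := hδ.exists_pathSemimodule_eq hα hn h
    rw [ha, hb, CylDyckPath.southEast_iff hm hmn hγ hδ]
  obtain ⟨γ, hγ, -⟩ := existsUnique_correspondsTo hβ hm hmn h z₀ rfl a
  obtain ⟨δ, hδ, -⟩ := existsUnique_correspondsTo hβ hm hmn h z₀ rfl b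
  exact ⟨fun ⟨_, _, hγ', hδ', hse⟩ => (key hγ' hδ').1 hse,
    fun hsub => ⟨γ, δ, hγ, hδ, (key hγ hδ).2 hsub⟩⟩

lemma isChain_southEast_iff (hα : α ≠ 0) (hβ : β ≠ 0) (hm : 0 < m) (hn : 0 < n)
    (hmn : m.Coprime n) (h : (m : ℂ) * α + (n : ℂ) * β = 0)
    {L : List (PathIn m n (z₀ : ℂ ⧸ latticeGroup α β))} :
    L.IsChain (SouthEast z₀) ↔ L.Pairwise fun a b => pathSemimodule z₀ b ⊆ pathSemimodule z₀ a := by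
  have : IsTrans (PathIn m n (z₀ : ℂ ⧸ latticeGroup α β)) fun a b =>
      pathSemimodule z₀ b ⊆ pathSemimodule z₀ a := ⟨fun _ _ _ hab hbc => hbc.trans hab⟩
  rw [← List.isChain_iff_pairwise]
  simp only [← southEast_iff hα hβ hm hn hmn h]

end PathSemimodule

section RootMultiplicity

variable {R : Type*} [CommRing R]

lemma rootMultiplicity_comp_X_add_C (p : R[X]) (b x : R) :
    (p.comp (X + C b)).rootMultiplicity x = p.rootMultiplicity (x + b) := by
  simpa using rootMultiplicity_comp_C_mul_X_add_C p 1 b x isUnit_one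

variable [IsDomain R]

lemma eq_of_rootMultiplicity_eq {p q : R[X]} (hp : p.Monic) (hq : q.Monic) (hp' : p.Splits)
    (hq' : q.Splits) (h : ∀ x, p.rootMultiplicity x = q.rootMultiplicity x) : p = q := by
  classical
  have roots_eq : p.roots = q.roots := by
    ext x
    rw [count_roots, count_roots, h]
  rw [hp'.eq_prod_roots_of_monic hp, hq'.eq_prod_roots_of_monic hq, roots_eq]

lemma rootMultiplicity_prod_X_sub_C_pow [DecidableEq R] {ι : Type*} (s : Finset ι) (f : ι → R)
    (k : ι → ℕ) (x : R) : (∏ i ∈ s, (X - C (f i)) ^ k i).rootMultiplicity x =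
      ∑ i ∈ s, k i * if f i = x then 1 else 0 := by
  have prod_ne_zero : ∏ i ∈ s, (X - C (f i)) ^ k i ≠ 0 :=
    Finset.prod_ne_zero_iff.2 fun i _ => pow_ne_zero _ (X_sub_C_ne_zero _)
  rw [← count_roots, roots_prod _ _ prod_ne_zero, Multiset.count_bind, Finset.sum]
  refine congrArg _ (Multiset.map_congr rfl fun i _ => ?_)
  rw [roots_pow, roots_X_sub_C, Multiset.count_nsmul, Multiset.count_singleton]
  simp only [eq_comm]

end RootMultiplicity

/-- `C` is the profile of the flow attached to a pair `P`: the zeros of `P.1` in the coset of `z₀`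
are the edges `e - m ⟶ e`, those of `P.2` the edges `e + n ⟶ e`, each at the node `e` in which
the edge ends. -/
def HasProfile (m n : ℕ) (α z₀ : ℂ) (P : ℂ[X] × ℂ[X]) (C : ℤ → ℕ) : Prop :=
  IsProfile m n (fun e => P.1.rootMultiplicity (node α n z₀ e))
    (fun e => P.2.rootMultiplicity (node α n z₀ e)) C

section Solutions

variable {α β : ℂ} {m n : ℕ} {z₀ : ℂ} {c : ℂ ⧸ latticeGroup α β} {A B P : ℂ[X] × ℂ[X]}
  {C D : ℤ → ℕ}

lemma IsSolution.exists_hasProfile (hα : α ≠ 0) (hm : 0 < m) (hn : 0 < n)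
    (h : (m : ℂ) * α + (n : ℂ) * β = 0) (hP : IsSolution α β P) (hP₁ : P.1 ≠ 0) (hP₂ : P.2 ≠ 0)
    (z₀ : ℂ) : ∃ C, HasProfile m n α z₀ P C ∧ BddAbove (Set.range C) := by
  have mul_ne : P.1 * P.2 ≠ 0 := mul_ne_zero hP₁ hP₂
  refine ShiftEq.exists_isProfile hm ?_ fun e => ?_
  · refine ((finite_setOfPred_isRoot mul_ne).preimage
      (node_injective (z₀ := z₀) hα hn).injOn).subset fun e he => ?_
    rw [Function.mem_support, Pi.add_apply, ← rootMultiplicity_mul mul_ne] at he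
    exact (rootMultiplicity_pos mul_ne).1 (Nat.pos_of_ne_zero he)
  · have up : node α n z₀ e + β = node α n z₀ (e + m) := by
      simpa using node_add (z₀ := z₀) hn h e 0 1
    have right : node α n z₀ e + α = node α n z₀ (e - n) := by
      simpa using node_add (z₀ := z₀) hn h e 1 0
    have eqn : P.1 * P.2 = P.1.comp (X + Polynomial.C β) * P.2.comp (X + Polynomial.C α) := hP
    rw [← rootMultiplicity_mul mul_ne, eqn, rootMultiplicity_mul (eqn ▸ mul_ne),
      rootMultiplicity_comp_X_add_C, rootMultiplicity_comp_X_add_C, up, right]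

lemma HasProfile.mul (hA : HasProfile m n α z₀ A C) (hB : HasProfile m n α z₀ B D)
    (h₁ : (A * B).1 ≠ 0) (h₂ : (A * B).2 ≠ 0) : HasProfile m n α z₀ (A * B) (C + D) := by
  unfold HasProfile
  simp only [Prod.fst_mul, Prod.snd_mul] at h₁ h₂ ⊢
  simp only [rootMultiplicity_mul h₁, rootMultiplicity_mul h₂]
  exact hA.add hB

lemma hasProfile_one : HasProfile m n α z₀ 1 0 := by
  have rootMultiplicity_one : ∀ z : ℂ, (1 : ℂ[X]).rootMultiplicity z = 0 :=
    fun z => rootMultiplicity_C 1 z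
  simp only [HasProfile, Prod.fst_one, Prod.snd_one, rootMultiplicity_one]
  exact .zero

lemma HasProfile.natDegree_eq_zero (hn : 0 < n) (hmn : m.Coprime n)
    (h : (m : ℂ) * α + (n : ℂ) * β = 0) (hP : HasProfile m n α z₀ P 0) (hP₀ : P.1 * P.2 ≠ 0)
    (hroot : ∀ z, (P.1 * P.2).IsRoot z → (z : ℂ ⧸ latticeGroup α β) = z₀) :
    P.1.natDegree = 0 ∧ P.2.natDegree = 0 := by
  obtain ⟨fst_eq, snd_eq⟩ := hP.left_unique .zero
  have roots_eq : (P.1 * P.2).roots = 0 := Multiset.eq_zero_of_forall_notMem fun z hz => by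
    have isRoot := isRoot_of_mem_roots hz
    obtain ⟨e, rfl⟩ := (mk_eq_mk_iff_exists_node hn hmn h).1 (hroot z isRoot)
    refine ((rootMultiplicity_pos hP₀).2 isRoot).ne' ?_
    rw [rootMultiplicity_mul hP₀]
    exact congrArg₂ _ (congrFun fst_eq e) (congrFun snd_eq e)
  rw [IsAlgClosed.roots_eq_zero_iff_natDegree_eq_zero, natDegree_mul
    (left_ne_zero_of_mul hP₀) (right_ne_zero_of_mul hP₀)] at roots_eq
  exact Nat.add_eq_zero_iff.1 roots_eq

lemma IsSolution.mul (hA : IsSolution α β A) (hB : IsSolution α β B) : IsSolution α β (A * B) := by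
  unfold IsSolution at *
  simp only [Prod.fst_mul, Prod.snd_mul, mul_comp]
  linear_combination B.1 * B.2 * hA +
    A.1.comp (X + Polynomial.C β) * A.2.comp (X + Polynomial.C α) * hB

lemma IsIntegralSolution.mul (hA : IsIntegralSolution α β c A) (hB : IsIntegralSolution α β c B) :
    IsIntegralSolution α β c (A * B) := by
  refine ⟨⟨hA.1.1.mul hB.1.1, hA.1.2.1.mul hB.1.2.1, hA.1.2.2.mul hB.1.2.2⟩, fun z hz => ?_⟩
  rw [Prod.fst_mul, Prod.snd_mul, mul_mul_mul_comm, root_mul] at hz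
  exact hz.elim (hA.2 z) (hB.2 z)

lemma isIntegralSolution_one : IsIntegralSolution α β c 1 :=
  ⟨⟨monic_one, monic_one, by simp [IsSolution]⟩, fun z hz => by simp at hz⟩

lemma IsIntegralSolution.eq_of_hasProfile (hn : 0 < n) (hmn : m.Coprime n)
    (h : (m : ℂ) * α + (n : ℂ) * β = 0) (hA : IsIntegralSolution α β z₀ A)
    (hB : IsIntegralSolution α β z₀ B) (hAC : HasProfile m n α z₀ A C)
    (hBC : HasProfile m n α z₀ B C) : A = B := by
  obtain ⟨fst_eq, snd_eq⟩ := hAC.left_unique hBC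
  have off_coset {P : ℂ[X] × ℂ[X]} (hP : IsIntegralSolution α β z₀ P) {z : ℂ}
      (hz : ¬ ∃ e, node α n z₀ e = z) : P.1.rootMultiplicity z = 0 ∧ P.2.rootMultiplicity z = 0 :=
    ⟨rootMultiplicity_eq_zero fun hr => hz
      ((mk_eq_mk_iff_exists_node hn hmn h).1 (hP.2 z (root_mul.2 (.inl hr)))),
    rootMultiplicity_eq_zero fun hr => hz
      ((mk_eq_mk_iff_exists_node hn hmn h).1 (hP.2 z (root_mul.2 (.inr hr))))⟩
  have rootMultiplicity_eq (z : ℂ) : A.1.rootMultiplicity z = B.1.rootMultiplicity z ∧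
      A.2.rootMultiplicity z = B.2.rootMultiplicity z := by
    by_cases hz : ∃ e, node α n z₀ e = z
    · obtain ⟨e, rfl⟩ := hz
      exact ⟨congrFun fst_eq e, congrFun snd_eq e⟩
    · simp only [off_coset hA hz, off_coset hB hz, and_self]
  exact Prod.ext
    (eq_of_rootMultiplicity_eq hA.1.1 hB.1.1 (IsAlgClosed.splits _) (IsAlgClosed.splits _)
      fun z => (rootMultiplicity_eq z).1)
    (eq_of_rootMultiplicity_eq hA.1.2.1 hB.1.2.1 (IsAlgClosed.splits _) (IsAlgClosed.splits _)
      fun z => (rootMultiplicity_eq z).2)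

end Solutions

section PathSolution

variable {α β : ℂ} {m n : ℕ} {z₀ : ℂ}

lemma pathSolution_fst_mul_snd (π : DyckPath m n) (z : ℂ) :
    (pathSolution α β π z).1 * (pathSolution α β π z).2 =
      ∏ i : Fin (m + n), (X - C (z + (π.pt i.succ).1 * α + (π.pt i.succ).2 * β)) := by
  rw [pathSolution, ← Finset.prod_mul_distrib]
  refine Finset.prod_congr rfl fun i _ => ?_
  rcases π.level_step 0 i with ⟨h₁, h₂, -⟩ | ⟨h₁, h₂, -⟩ <;> simp [h₁, h₂]

lemma pathSolution_fst_mul_snd_eq_prod_castSucc (h : (m : ℂ) * α + (n : ℂ) * β = 0)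
    (π : DyckPath m n) (z : ℂ) : (pathSolution α β π z).1 * (pathSolution α β π z).2 =
      ∏ i : Fin (m + n), (X - C (z + (π.pt i.castSucc).1 * α + (π.pt i.castSucc).2 * β)) := by
  set g : Fin (m + n + 1) → ℂ[X] := fun i => X - C (z + (π.pt i).1 * α + (π.pt i).2 * β)
  have g_last : g (Fin.last _) = g 0 := by
    simp only [g, π.start, π.finish, add_assoc, h, Nat.cast_zero, zero_mul, add_zero]
  have prod_succ := Fin.prod_univ_succ g
  rw [Fin.prod_univ_castSucc, g_last, mul_comm] at prod_succ
  rw [pathSolution_fst_mul_snd]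
  exact (mul_left_cancel₀ (X_sub_C_ne_zero _) prod_succ).symm

lemma isSolution_pathSolution (h : (m : ℂ) * α + (n : ℂ) * β = 0) (π : DyckPath m n) (z : ℂ) :
    IsSolution α β (pathSolution α β π z) := by
  rw [IsSolution, pathSolution_fst_mul_snd_eq_prod_castSucc h, pathSolution, prod_comp, prod_comp,
    ← Finset.prod_mul_distrib]
  refine Finset.prod_congr rfl fun i _ => ?_
  rcases π.step i with hs | hs <;>
  · simp only [hs, Nat.add_eq_left, one_ne_zero, ↓reduceIte, pow_zero, pow_one, one_mul, mul_one,
      one_comp, sub_comp, add_comp, Polynomial.mul_comp, X_comp, C_comp, Nat.cast_add, Nat.cast_one,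
      C_add, C_mul, C_1]
    ring

lemma isIntegralSolution_pathSolution (h : (m : ℂ) * α + (n : ℂ) * β = 0)
    {c : ℂ ⧸ latticeGroup α β} (a : PathIn m n c) :
    IsIntegralSolution α β c (pathSolution α β a.1 a.2) := by
  have monic_prod (w : Fin (m + n) → ℂ) (k : Fin (m + n) → ℕ) : (∏ i, (X - C (w i)) ^ k i).Monic :=
    monic_prod_of_monic _ _ fun i _ => (monic_X_sub_C _).pow _
  refine ⟨⟨monic_prod _ _, monic_prod _ _, isSolution_pathSolution h a.1 _⟩, fun z hz => ?_⟩
  rw [pathSolution_fst_mul_snd, isRoot_prod] at hz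
  obtain ⟨i, -, hi⟩ := hz
  rw [root_X_sub_C] at hi
  rw [← a.2.2, mk_eq_mk_iff]
  exact ⟨(a.1.pt i.succ).1, (a.1.pt i.succ).2, mod_cast hi.symm⟩

lemma hasProfile_pathSolution (hα : α ≠ 0) (hm : 0 < m) (hn : 0 < n) (hmn : m.Coprime n)
    (h : (m : ℂ) * α + (n : ℂ) * β = 0) (a : PathIn m n (z₀ : ℂ ⧸ latticeGroup α β)) :
    HasProfile m n α z₀ (pathSolution α β a.1 a.2) ((pathSemimodule z₀ a).indicator 1) := by
  obtain ⟨t, ht⟩ := exists_node_eq hn hmn h a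
  have point_eq_node (i) : (a.2 : ℂ) + (a.1.pt i).1 * α + (a.1.pt i).2 * β =
      node α n z₀ (a.1.level t i) := by
    simpa [ht, DyckPath.level] using node_add (z₀ := z₀) hn h t (a.1.pt i).1 (a.1.pt i).2
  rw [pathSemimodule_eq hα hn ht]
  unfold HasProfile pathSolution
  simp only [point_eq_node, rootMultiplicity_prod_X_sub_C_pow, (node_injective hα hn).eq_iff]
  exact DyckPath.isProfile hm hmn

lemma isIrreducibleSolution_pathSolution (hα : α ≠ 0) (hm : 0 < m) (hn : 0 < n)
    (hmn : m.Coprime n) (h : (m : ℂ) * α + (n : ℂ) * β = 0)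
    (a : PathIn m n (z₀ : ℂ ⧸ latticeGroup α β)) :
    IsIrreducibleSolution α β (pathSolution α β a.1 a.2) := by
  have integral := isIntegralSolution_pathSolution h a
  have profile := hasProfile_pathSolution hα hm hn hmn h a
  refine ⟨integral.1, fun eq_one => ?_, fun A B hA hB hAB => ?_⟩
  · obtain ⟨e, he⟩ := pathSemimodule_nonempty hm hn hmn h a
    rw [eq_one] at profile
    simpa [he] using congrFun (profile.unique hm hasProfile_one) e
  · rw [hAB] at integral profile
    have ne₁ : A.1 * B.1 ≠ 0 := integral.1.1.ne_zero
    have ne₂ : A.2 * B.2 ≠ 0 := integral.1.2.1.ne_zero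
    obtain ⟨hA₁, hB₁⟩ := mul_ne_zero_iff.1 ne₁
    obtain ⟨hA₂, hB₂⟩ := mul_ne_zero_iff.1 ne₂
    obtain ⟨CA, hCA, -⟩ := hA.exists_hasProfile hα hm hn h hA₁ hA₂ z₀
    obtain ⟨CB, hCB, -⟩ := hB.exists_hasProfile hα hm hn h hB₁ hB₂ z₀
    have add_le_one (e) : (CA + CB) e ≤ 1 := by
      rw [(hCA.mul hCB ne₁ ne₂).unique hm profile]
      exact Set.indicator_le_self' (by simp) e
    rcases hCA.eq_zero_or_eq_zero_of_add_le_one hmn hCB add_le_one with rfl | rfl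
    · exact .inl (hCA.natDegree_eq_zero hn hmn h (mul_ne_zero hA₁ hA₂) fun z hz =>
        integral.2 z (hz.dvd (mul_dvd_mul ⟨B.1, rfl⟩ ⟨B.2, rfl⟩)))
    · exact .inr (hCB.natDegree_eq_zero hn hmn h (mul_ne_zero hB₁ hB₂) fun z hz =>
        integral.2 z (hz.dvd (mul_dvd_mul ⟨A.1, mul_comm _ _⟩ ⟨A.2, mul_comm _ _⟩)))

lemma isIntegralSolution_list_prod (h : (m : ℂ) * α + (n : ℂ) * β = 0)
    {c : ℂ ⧸ latticeGroup α β} (L : List (PathIn m n c)) :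
    IsIntegralSolution α β c (L.map fun a => pathSolution α β a.1 a.2).prod := by
  refine List.prod_induction (IsIntegralSolution α β c) (fun _ _ => IsIntegralSolution.mul)
    isIntegralSolution_one fun P hP => ?_
  obtain ⟨a, -, rfl⟩ := List.mem_map.1 hP
  exact isIntegralSolution_pathSolution h a

lemma hasProfile_list_prod (hα : α ≠ 0) (hm : 0 < m) (hn : 0 < n) (hmn : m.Coprime n)
    (h : (m : ℂ) * α + (n : ℂ) * β = 0) (L : List (PathIn m n (z₀ : ℂ ⧸ latticeGroup α β))) :
    HasProfile m n α z₀ (L.map fun a => pathSolution α β a.1 a.2).prod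
      fun e => (L.map fun a => (pathSemimodule z₀ a).indicator 1 e).sum := by
  induction L with
  | nil => exact hasProfile_one
  | cons a L ih =>
    have integral := isIntegralSolution_list_prod h (a :: L)
    simp only [List.map_cons, List.prod_cons, List.sum_cons] at integral ⊢
    exact (hasProfile_pathSolution hα hm hn hmn h a).mul ih integral.1.1.ne_zero
      integral.1.2.1.ne_zero

lemma IsIntegralSolution.eq_list_prod_iff (hα : α ≠ 0) (hm : 0 < m) (hn : 0 < n)
    (hmn : m.Coprime n) (h : (m : ℂ) * α + (n : ℂ) * β = 0) {P : ℂ[X] × ℂ[X]} {C : ℤ → ℕ}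
    (hP : IsIntegralSolution α β z₀ P) (hC : HasProfile m n α z₀ P C)
    {L : List (PathIn m n (z₀ : ℂ ⧸ latticeGroup α β))} :
    P = (L.map fun a => pathSolution α β a.1 (a.2 : ℂ)).prod ↔
      ∀ e, (L.map fun a => (pathSemimodule z₀ a).indicator (1 : ℤ → ℕ) e).sum = C e := by
  have profile := hasProfile_list_prod hα hm hn hmn h L
  constructor
  · rintro rfl
    exact congrFun (profile.unique hm hC)
  · intro sum_eq
    rw [funext sum_eq] at profile
    exact hP.eq_of_hasProfile hn hmn h (isIntegralSolution_list_prod h L) hC profile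

end PathSolution

end ShiftEq

theorem theoremC (α β : ℂ) (hα : α ≠ 0) (hβ : β ≠ 0)
    (m n : ℕ) (hm : 0 < m) (hn : 0 < n) (hmn : Nat.Coprime m n)
    (h : (m : ℂ) * α + (n : ℂ) * β = 0)
    (c : ℂ ⧸ latticeGroup α β) (z₀ : ℂ) (hz₀ : (z₀ : ℂ ⧸ latticeGroup α β) = c)
    (p q : Polynomial ℂ) (hpq : IsIntegralSolution α β c (p, q)) :
    (∀ a : PathIn m n c, IsIrreducibleSolution α β (pathSolution α β a.1 (a.2 : ℂ))) ∧
    ∃! L : List (PathIn m n c),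
      List.IsChain (SouthEast z₀) L ∧
      (p, q) = (L.map fun a => pathSolution α β a.1 (a.2 : ℂ)).prod := by
  subst hz₀
  refine ⟨isIrreducibleSolution_pathSolution hα hm hn hmn h, ?_⟩
  obtain ⟨C, profile, bddAbove⟩ :=
    hpq.1.2.2.exists_hasProfile hα hm hn h hpq.1.1.ne_zero hpq.1.2.1.ne_zero z₀
  simp only [isChain_southEast_iff hα hβ hm hn hmn h, hpq.eq_list_prod_iff hα hm hn hmn h profile]
  exact existsUnique_list_sum_indicator_eq (pathSemimodule_injective hα hm hn hmn h)
    (pathSemimodule_nonempty hm hn hmn h) bddAbove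
    fun i hi => (profile.isSemimodule_setOf_lt hi).mem_range_pathSemimodule hα hm hn hmn h
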